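/- Let $m\ge 3$, let $X_k=(x^{(k)}_{ij})_{1\le i,j\le 2}$ for $k=1,\dots,m$ be $2\times 2$ matrices of independent indeterminates, and let $R=\mathbb{C}[x^{(k)}_{ij}]$. Let $\operatorname{Sing}_{2,m}\subseteq(\mathbb{C}^{2\times 2})^m$ be the set of all tuples $(A_1,\dots,A_m)$ such that $\sum_{k}\lambda_kA_k$ is singular for every $\lambda\in\mathbb{Q}^m$. Let $I=I(\operatorname{Sing}_{2,m})\subseteq R$ be the ideal of all polynomials vanishing on $\operatorname{Sing}_{2,m}$, let $I_2$ be the $\mathbb{C}$-vector space of its homogeneous elements of degree $2$ (including $0$), and let $J\subseteq R$ be the ideal generated by $I_2$. Then: 1. $I_2$ is the $\mathbb{C}$-linear span of the quadrics $\det(\lambda_1X_1+\dots+\lambda_mX_m)$, $\lambda\in\mathbb{C}^m$; hence $J$ is the ideal generated by these quadrics. 2. $J$ is not a radical ideal. 3. $I=\sqrt{J}$. 4. $I$ is generated by $I_2$ together with all $3\times 3$ minors of the flattening $\mathbb{C}^m\to\mathbb{C}^2\otimes\mathbb{C}^2$, $e_k\mapsto X_k$, that is, of the $4\times m$ matrix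 whose $k$-th column consists of the four entries of $X_k$. -/

import Mathlib

open MvPolynomial

/-- The coordinates `x_{ij}^{(k)}` on `m`-tuples of `n × n` matrices, indexed by `(k, i, j)`. -/
abbrev TupleVar (n m : ℕ) : Type := Fin m × Fin n × Fin n

/-- The `k`-th matrix of the tuple with coordinate vector `x`. With `x = X` (the indeterminates)
this is the `k`-th generic matrix. -/
def tupleMatrix {R : Type*} {n m : ℕ} (x : TupleVar n m → R) (k : Fin m) :
    Matrix (Fin n) (Fin n) R :=
  Matrix.of fun i j => x (k, i, j)

/-- The variety of `m`-tuples of complex `n × n` matrices all of whose rational linear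
combinations are singular. -/
def singVariety (n m : ℕ) : Set (TupleVar n m → ℂ) :=
  {x | ∀ c : Fin m → ℚ, (∑ k, (c k : ℂ) • tupleMatrix x k).det = 0}

/-- The ideal of all complex polynomials vanishing on `singVariety n m`. -/
noncomputable def singIdeal (n m : ℕ) : Ideal (MvPolynomial (TupleVar n m) ℂ) :=
  vanishingIdeal ℂ (singVariety n m)

/-- The degree `d` component of `singIdeal n m`, as a complex vector space. -/
noncomputable def singIdealComponent (n m d : ℕ) :
    Submodule ℂ (MvPolynomial (TupleVar n m) ℂ) :=
  (singIdeal n m).restrictScalars ℂ ⊓ homogeneousSubmodule (TupleVar n m) ℂ d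

/-- The form `det (c₁ X₁ + ⋯ + c_m X_m)` in the generic matrices `X₁, …, X_m`. -/
noncomputable def detForm (n m : ℕ) (c : Fin m → ℂ) : MvPolynomial (TupleVar n m) ℂ :=
  (∑ k, (C (c k) : MvPolynomial (TupleVar n m) ℂ) • tupleMatrix X k).det

/-- The generic matrix of the flattening `ℂ^m → ℂ^n ⊗ ℂ^n`, `e_k ↦ X_k`: its `k`-th column lists
the entries of the `k`-th generic matrix. -/
noncomputable def flattening (n m : ℕ) :
    Matrix (Fin n × Fin n) (Fin m) (MvPolynomial (TupleVar n m) ℂ) :=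
  Matrix.of fun ij k => X (k, ij.1, ij.2)

/-- The `r × r` minors (up to sign) of the flattening. -/
def flatteningMinors (n m r : ℕ) : Set (MvPolynomial (TupleVar n m) ℂ) :=
  {p | ∃ (a : Fin r ↪ Fin n × Fin n) (b : Fin r ↪ Fin m),
    p = ((flattening n m).submatrix a b).det}

/-!
A polynomial vanishing on the singular tuples vanishes on the tuples `(u vₖᵀ)ₖ` and `(vₖ uᵀ)ₖ`, so
it is killed by the monomial maps `x_{ij}^{(k)} ↦ u_i v_{kj}` and `x_{ij}^{(k)} ↦ u_j v_{ki}`.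
Modulo the quadrics and the `3 × 3` minors, the mixed second difference of a monomial under
permuting its row indices and permuting its column indices is zero; it suffices to check this for
two transpositions on at most three letters. Averaging over all permutations therefore writes the
quotient map as a sum of two linear maps, one factoring through each of the two monomial maps, and
so it kills every polynomial vanishing on the singular tuples.

The quadrics cut out the singular tuples, so the Nullstellensatz gives the radical, and comparing
degrees gives the component of degree `2`. The ideal of the quadrics is not radical because over
`ℂ[ε₁, ε₂] / (ε₁², ε₂²)` there is a tuple annihilating the quadrics but not all `3 × 3` minors.
-/

section Words

open Equiv Finset

variable {κ α β ι ι' A : Type*} [CommRing A] [Fintype ι] [Fintype ι']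

/-- The product of the entries of `x` listed by a word `k` of layers, a word `p` of rows and a
word `q` of columns. -/
def wordProd (x : κ × α × β → A) (k : ι → κ) (p : ι → α) (q : ι → β) : A :=
  ∏ t, x (k t, p t, q t)

theorem wordProd_comp_equiv (x : κ × α × β → A) (k : ι → κ) (p : ι → α) (q : ι → β) (ρ : ι' ≃ ι) :
    wordProd x (k ∘ ρ) (p ∘ ρ) (q ∘ ρ) = wordProd x k p q :=
  ρ.prod_comp fun t => x (k t, p t, q t)

theorem wordProd_eq_mul_prod_compl [DecidableEq ι] (x : κ × α × β → A) (k : ι → κ)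
    {p p' : ι → α} {q q' : ι → β} (e : ι' ↪ ι) (hp : ∀ t ∉ Set.range e, p' t = p t)
    (hq : ∀ t ∉ Set.range e, q' t = q t) :
    wordProd x k p' q' = wordProd x (k ∘ e) (p' ∘ e) (q' ∘ e) *
      ∏ t ∈ (univ.map e)ᶜ, x (k t, p t, q t) := by
  rw [wordProd, ← prod_mul_prod_compl (univ.map e), prod_map]
  refine congrArg _ (prod_congr rfl fun t ht => ?_)
  have ht' : t ∉ Set.range e := by simpa using ht
  rw [hp t ht', hq t ht']

theorem comp_swap_apply_of_notMem_range {ι ι' γ : Type*} [DecidableEq ι] (w : ι → γ) (e : ι' ↪ ι)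
    (i j : ι') : ∀ t ∉ Set.range e, (w ∘ swap (e i) (e j)) t = w t := fun _ ht =>
  congrArg w (swap_apply_of_ne_of_ne (fun h => ht ⟨i, h.symm⟩) fun h => ht ⟨j, h.symm⟩)

theorem comp_swap_comp_embedding {ι ι' γ : Type*} [DecidableEq ι] [DecidableEq ι'] (w : ι → γ)
    (e : ι' ↪ ι) (i j : ι') : (w ∘ swap (e i) (e j)) ∘ e = (w ∘ e) ∘ swap i j :=
  funext fun t => congrArg w (e.swap_apply i j t)

/-- The mixed second difference of `wordProd x k`, in the directions of permuting the row word by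
`σ` and the column word by `τ`, is identically zero. Equivalently, permuting the rows by `σ` changes
`wordProd x k` by an amount that is invariant under permuting the columns by `τ`. -/
def MixedDiffVanishes (x : κ × α × β → A) (k : ι → κ) (σ τ : Perm ι) : Prop :=
  ∀ p q, wordProd x k (p ∘ σ) (q ∘ τ) - wordProd x k (p ∘ σ) q - wordProd x k p (q ∘ τ) +
    wordProd x k p q = 0

namespace MixedDiffVanishes

variable {x : κ × α × β → A} {k : ι → κ} {σ σ' τ τ' : Perm ι}

theorem one_left : MixedDiffVanishes x k 1 τ := fun p q => by simp

theorem one_right : MixedDiffVanishes x k σ 1 := fun p q => by simp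

theorem mul_left (h : MixedDiffVanishes x k σ τ) (h' : MixedDiffVanishes x k σ' τ) :
    MixedDiffVanishes x k (σ * σ') τ := fun p q => by
  rw [Perm.coe_mul, ← Function.comp_assoc]
  linear_combination h p q + h' (p ∘ σ) q

theorem mul_right (h : MixedDiffVanishes x k σ τ) (h' : MixedDiffVanishes x k σ τ') :
    MixedDiffVanishes x k σ (τ * τ') := fun p q => by
  rw [Perm.coe_mul, ← Function.comp_assoc]
  linear_combination h p q + h' p (q ∘ τ)

theorem swap_of_embedding [DecidableEq ι] [DecidableEq ι'] (e : ι' ↪ ι) {i j i' j' : ι'}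
    (h : MixedDiffVanishes x (k ∘ e) (swap i j) (swap i' j')) :
    MixedDiffVanishes x k (swap (e i) (e j)) (swap (e i') (e j')) := fun p q => by
  rw [wordProd_eq_mul_prod_compl x k e (comp_swap_apply_of_notMem_range p e i j)
      (comp_swap_apply_of_notMem_range q e i' j'),
    wordProd_eq_mul_prod_compl x k e (comp_swap_apply_of_notMem_range p e i j) fun _ _ => rfl,
    wordProd_eq_mul_prod_compl x k e (fun _ _ => rfl) (comp_swap_apply_of_notMem_range q e i' j'),
    wordProd_eq_mul_prod_compl x k e (p := p) (q := q) (fun _ _ => rfl) fun _ _ => rfl,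
    comp_swap_comp_embedding, comp_swap_comp_embedding]
  linear_combination (∏ t ∈ (univ.map e)ᶜ, x (k t, p t, q t)) * h (p ∘ e) (q ∘ e)

theorem swap_swap_of_ne [DecidableEq ι]
    (h₂ : ∀ k : Fin 2 → κ, MixedDiffVanishes x k (swap 0 1) (swap 0 1))
    (h₃ : ∀ k : Fin 3 → κ, MixedDiffVanishes x k (swap 0 1) (swap 0 2)) (k : ι → κ)
    {s t u v : ι} (hst : s ≠ t) (huv : u ≠ v) : MixedDiffVanishes x k (swap s t) (swap u v) := by
  have common_letter {u : ι} (hsu : s ≠ u) : MixedDiffVanishes x k (swap s t) (swap s u) := by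
    by_cases htu : t = u
    · obtain ⟨e, rfl, rfl⟩ : ∃ e : Fin 2 ↪ ι, e 0 = s ∧ e 1 = t :=
        ⟨⟨![s, t], by simp [Function.Injective, Fin.forall_fin_two, hst, hst.symm]⟩, rfl, rfl⟩
      exact htu ▸ swap_of_embedding e (h₂ (k ∘ e))
    · obtain ⟨e, rfl, rfl, rfl⟩ : ∃ e : Fin 3 ↪ ι, e 0 = s ∧ e 1 = t ∧ e 2 = u :=
        ⟨⟨![s, t, u], by
          simp [Function.Injective, Fin.forall_fin_succ, hst, hsu, htu, hst.symm, hsu.symm,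
            Ne.symm htu]⟩, rfl, rfl, rfl⟩
      exact swap_of_embedding e (h₃ (k ∘ e))
  by_cases hu : s = u
  · exact hu ▸ common_letter (hu ▸ huv)
  by_cases hv : s = v
  · rw [swap_comm u]
    exact hv ▸ common_letter hu
  rw [← swap_mul_swap_mul_swap (Ne.symm hv) huv.symm, swap_comm v s]
  exact ((common_letter hu).mul_right (common_letter hv)).mul_right (common_letter hu)

theorem of_swaps (h₂ : ∀ k : Fin 2 → κ, MixedDiffVanishes x k (swap 0 1) (swap 0 1))
    (h₃ : ∀ k : Fin 3 → κ, MixedDiffVanishes x k (swap 0 1) (swap 0 2)) (k : ι → κ)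
    (σ τ : Perm ι) : MixedDiffVanishes x k σ τ := by
  classical
  induction σ using Perm.swap_induction_on with
  | one => exact one_left
  | swap_mul σ s t hst ih =>
    refine mul_left ?_ ih
    clear ih
    induction τ using Perm.swap_induction_on with
    | one => exact one_right
    | swap_mul τ u v huv ih => exact (swap_swap_of_ne h₂ h₃ k hst huv).mul_right ih

end MixedDiffVanishes

end Words

section Means

open Equiv Finset
open scoped BigOperators

variable {κ α β ι ι' A : Type*} [CommRing A] [Module ℚ≥0 A] [Fintype ι] [DecidableEq ι]
  [Fintype ι'] [DecidableEq ι']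

theorem expect_perm_comp_equiv {γ M : Type*} [AddCommMonoid M] [Module ℚ≥0 M]
    {u : (ι → γ) → M} {u' : (ι' → γ) → M} (ρ π : ι' ≃ ι) (hu : ∀ w, u' (w ∘ ρ) = u w)
    (w : ι → γ) : 𝔼 σ : Perm ι', u' ((w ∘ π) ∘ σ) = 𝔼 σ : Perm ι, u (w ∘ σ) := by
  refine Fintype.expect_equiv (ρ.equivCongr π) _ _ fun σ => ?_
  rw [← hu]
  refine congrArg u' (funext fun t => ?_)
  simp

/-- The average of `wordProd x k p q` over all permutations of the row word. It depends only on the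
multisets of rows and of pairs (layer, column). -/
noncomputable def rowMean (x : κ × α × β → A) (k : ι → κ) (p : ι → α) (q : ι → β) : A :=
  𝔼 σ : Perm ι, wordProd x k (p ∘ σ) q

/-- The average of `wordProd x k p q - rowMean x k p q` over all permutations of the column word. It
depends only on the multisets of columns and of pairs (layer, row). -/
noncomputable def colResidualMean (x : κ × α × β → A) (k : ι → κ) (p : ι → α) (q : ι → β) : A :=
  𝔼 τ : Perm ι, (wordProd x k p (q ∘ τ) - rowMean x k p (q ∘ τ))

theorem rowMean_comp_equiv (x : κ × α × β → A) (k : ι → κ) (p : ι → α) (q : ι → β)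
    (π ρ : ι' ≃ ι) : rowMean x (k ∘ ρ) (p ∘ π) (q ∘ ρ) = rowMean x k p q :=
  expect_perm_comp_equiv (u := fun p => wordProd x k p q)
    (u' := fun p => wordProd x (k ∘ ρ) p (q ∘ ρ)) ρ π (fun p => wordProd_comp_equiv x k p q ρ) p

theorem colResidualMean_comp_equiv (x : κ × α × β → A) (k : ι → κ) (p : ι → α) (q : ι → β)
    (π ρ : ι' ≃ ι) : colResidualMean x (k ∘ ρ) (p ∘ ρ) (q ∘ π) = colResidualMean x k p q :=
  expect_perm_comp_equiv (u := fun q => wordProd x k p q - rowMean x k p q)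
    (u' := fun q => wordProd x (k ∘ ρ) (p ∘ ρ) q - rowMean x (k ∘ ρ) (p ∘ ρ) q) ρ π
    (fun q => by rw [wordProd_comp_equiv, rowMean_comp_equiv]) q

theorem wordProd_sub_rowMean_comp_perm {x : κ × α × β → A} {k : ι → κ} {τ : Perm ι}
    (h : ∀ σ, MixedDiffVanishes x k σ τ) (p : ι → α) (q : ι → β) :
    wordProd x k p (q ∘ τ) - rowMean x k p (q ∘ τ) = wordProd x k p q - rowMean x k p q := by
  have hmean := expect_eq_zero (s := univ) fun σ _ => h σ p q
  rw [expect_add_distrib, expect_sub_distrib, expect_sub_distrib, Fintype.expect_const,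
    Fintype.expect_const] at hmean
  linear_combination (norm := (unfold rowMean; ring)) -hmean

theorem wordProd_eq_rowMean_add_colResidualMean {x : κ × α × β → A} {k : ι → κ}
    (h : ∀ σ τ, MixedDiffVanishes x k σ τ) (p : ι → α) (q : ι → β) :
    wordProd x k p q = rowMean x k p q + colResidualMean x k p q := by
  rw [colResidualMean, expect_congr rfl fun τ _ =>
    wordProd_sub_rowMean_comp_perm (fun σ => h σ τ) p q, Fintype.expect_const, add_sub_cancel]

end Means

section SplitMaps

open Equiv Finset

variable {V α β R : Type*} [CommSemiring R]

theorem exists_equiv_of_map_univ_eq {ι ι' γ : Type*} [Fintype ι] [Fintype ι'] {f : ι → γ}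
    {f' : ι' → γ} (h : univ.val.map f = univ.val.map f') : ∃ ρ : ι' ≃ ι, f' = f ∘ ρ := by
  classical
  have fiberEquiv (c : γ) : Nonempty ({t // f' t = c} ≃ {t // f t = c}) := by
    refine ⟨Fintype.equivOfCardEq ?_⟩
    have hc := congrArg (Multiset.count c) h
    simp only [Multiset.count_map, eq_comm (a := c)] at hc
    simpa only [Fintype.card_subtype] using! hc.symm
  exact ⟨Equiv.ofFiberEquiv fun c => (fiberEquiv c).some,
    funext fun t => (Equiv.ofFiberEquiv_map (fun c => (fiberEquiv c).some) t).symm⟩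

theorem exists_equiv_of_mapDomain_eq {ι ι' γ : Type*} [Fintype ι] [Fintype ι'] {w : ι → V}
    {w' : ι' → V} {s s' : V →₀ ℕ} (hw : univ.val.map w = Finsupp.toMultiset s)
    (hw' : univ.val.map w' = Finsupp.toMultiset s') {f : V → γ}
    (h : s.mapDomain f = s'.mapDomain f) : ∃ ρ : ι' ≃ ι, f ∘ w' = (f ∘ w) ∘ ρ :=
  exists_equiv_of_map_univ_eq <| by
    rw [← Multiset.map_map, ← Multiset.map_map, hw, hw', Finsupp.toMultiset_map,
      Finsupp.toMultiset_map, h]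

theorem exists_map_univ_eq_toMultiset (s : V →₀ ℕ) :
    ∃ (n : ℕ) (w : Fin n → V), univ.val.map w = Finsupp.toMultiset s := by
  obtain ⟨l, hl⟩ := Quot.exists_rep (Finsupp.toMultiset s)
  exact ⟨l.length, l.get, by rw [Fin.univ_val_map, List.ofFn_get]; exact hl⟩

theorem monomial_eq_prod_of_map_univ_eq {ι : Type*} [Fintype ι] {s : V →₀ ℕ} {w : ι → V}
    (h : univ.val.map w = Finsupp.toMultiset s) :
    (monomial s 1 : MvPolynomial V R) = ∏ t, X (w t) := by
  rw [monomial_eq, C_1, one_mul, prod_eq_multiset_prod, ← Function.comp_def X w,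
    ← Multiset.map_map, h, Finsupp.toMultiset_map, Finsupp.prod_toMultiset,
    Finsupp.prod_mapDomain_index (fun _ => pow_zero _) fun _ => pow_add _]

/-- The monomial map `X i ↦ X (f i) * X (g i)`. Over an infinite domain its kernel consists of the
polynomials vanishing at all points with coordinates `a (f i) * b (g i)`. -/
noncomputable def splitHom (f : V → α) (g : V → β) :
    MvPolynomial V R →ₐ[R] MvPolynomial (α ⊕ β) R :=
  aeval fun i => X (Sum.inl (f i)) * X (Sum.inr (g i))

theorem splitHom_monomial (f : V → α) (g : V → β) (s : V →₀ ℕ) :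
    splitHom f g (monomial s (1 : R)) =
      monomial (Finsupp.sumFinsuppAddEquivProdFinsupp.symm (s.mapDomain f, s.mapDomain g)) 1 := by
  induction s using Finsupp.induction_linear with
  | zero => simp [splitHom]
  | add s t hs ht =>
    rw [← mul_one (1 : R), ← monomial_mul, map_mul, hs, ht, monomial_mul, ← map_add,
      Finsupp.mapDomain_add, Finsupp.mapDomain_add, Prod.mk_add_mk]
  | single i n =>
    have hsum : Finsupp.sumFinsuppAddEquivProdFinsupp.symm
        (Finsupp.single (f i) n, Finsupp.single (g i) n) =
        Finsupp.single (Sum.inl (f i)) n + Finsupp.single (Sum.inr (g i)) n := by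
      classical
      ext (a | b) <;> simp [Finsupp.single_apply]
    rw [Finsupp.mapDomain_single, Finsupp.mapDomain_single, hsum, ← X_pow_eq_monomial, map_pow,
      splitHom, aeval_X, mul_pow, X_pow_eq_monomial, X_pow_eq_monomial, monomial_mul, one_mul]

theorem splitHom_eq_zero_of_forall_eval {R : Type*} [CommRing R] [IsDomain R] [Infinite R]
    {f : V → α} {g : V → β} {P : MvPolynomial V R}
    (hP : ∀ (a : α → R) (b : β → R), eval (fun i => a (f i) * b (g i)) P = 0) :
    splitHom f g P = 0 := by
  refine MvPolynomial.funext fun z => ?_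
  rw [map_zero, ← hP (z ∘ Sum.inl) (z ∘ Sum.inr), splitHom, ← coe_aeval_eq_eval,
    ← coe_aeval_eq_eval, RingHom.coe_coe, RingHom.coe_coe, ← AlgHom.comp_apply, comp_aeval]
  simp

theorem map_eq_zero_of_splitHom_eq_zero {M : Type*} [AddCommMonoid M] [Module R M]
    {f : V → α} {g : V → β} (Ψ : MvPolynomial V R →ₗ[R] M)
    (hΨ : ∀ s s' : V →₀ ℕ, s.mapDomain f = s'.mapDomain f → s.mapDomain g = s'.mapDomain g →
      Ψ (monomial s 1) = Ψ (monomial s' 1))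
    {P : MvPolynomial V R} (hP : splitHom f g P = 0) : Ψ P = 0 := by
  let e (s : V →₀ ℕ) :=
    Finsupp.sumFinsuppAddEquivProdFinsupp.symm (s.mapDomain f, s.mapDomain g)
  have hfac : Function.FactorsThrough (fun s => Ψ (monomial s 1)) e := fun s s' h => by
    obtain ⟨hf, hg⟩ := Prod.ext_iff.1 (AddEquiv.injective _ h)
    exact hΨ s s' hf hg
  let L := (basisMonomials (α ⊕ β) R).constr R (Function.extend e (fun s => Ψ (monomial s 1)) 0)
  have hL : Ψ = L ∘ₗ (splitHom f g).toLinearMap := by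
    refine (basisMonomials V R).ext fun s => ?_
    have hs := (basisMonomials (α ⊕ β) R).constr_basis R
      (Function.extend e (fun s => Ψ (monomial s 1)) 0) (e s)
    rw [hfac.extend_apply, coe_basisMonomials] at hs
    simpa only [coe_basisMonomials, LinearMap.comp_apply, AlgHom.toLinearMap_apply,
      splitHom_monomial] using hs.symm
  simp [hL, hP]

variable {κ A : Type*} [CommRing A] [Module ℚ≥0 A] [Algebra R A]

theorem map_eq_zero_of_mixedDiffVanishes (Φ : MvPolynomial (κ × α × β) R →ₐ[R] A)
    (hΦ : ∀ (n : ℕ) (k : Fin n → κ) (σ τ : Perm (Fin n)),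
      MixedDiffVanishes (fun v => Φ (X v)) k σ τ)
    {P : MvPolynomial (κ × α × β) R}
    (hrow : splitHom (fun v => v.2.1) (fun v => (v.1, v.2.2)) P = 0)
    (hcol : splitHom (fun v => v.2.2) (fun v => (v.1, v.2.1)) P = 0) : Φ P = 0 := by
  choose n w hw using exists_map_univ_eq_toMultiset (V := κ × α × β)
  let x (v : κ × α × β) : A := Φ (X v)
  let k (s) (t : Fin (n s)) : κ := (w s t).1
  let p (s) (t : Fin (n s)) : α := (w s t).2.1
  let q (s) (t : Fin (n s)) : β := (w s t).2.2
  let b := basisMonomials (κ × α × β) R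
  let F := b.constr R fun s => rowMean x (k s) (p s) (q s)
  let G := b.constr R fun s => colResidualMean x (k s) (p s) (q s)
  have hF_monomial (s) : F (monomial s 1) = rowMean x (k s) (p s) (q s) := b.constr_basis R _ s
  have hG_monomial (s) : G (monomial s 1) = colResidualMean x (k s) (p s) (q s) :=
    b.constr_basis R _ s
  have hΦ_monomial (s) : Φ (monomial s 1) = wordProd x (k s) (p s) (q s) := by
    rw [monomial_eq_prod_of_map_univ_eq (hw s), map_prod, wordProd]
  have hΦFG : Φ.toLinearMap = F + G := b.ext fun s =>
    (hΦ_monomial s).trans <|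
      (wordProd_eq_rowMean_add_colResidualMean (hΦ (n s) (k s)) (p s) (q s)).trans
        (congrArg₂ (· + ·) (hF_monomial s) (hG_monomial s)).symm
  have hF : F P = 0 := map_eq_zero_of_splitHom_eq_zero F (fun s s' hf hg => by
    obtain ⟨π, hπ⟩ := exists_equiv_of_mapDomain_eq (hw s) (hw s') hf
    obtain ⟨ρ, hρ⟩ := exists_equiv_of_mapDomain_eq (hw s) (hw s') hg
    have hk : k s' = k s ∘ ρ := (congrArg (Prod.fst ∘ ·) hρ :)
    have hq : q s' = q s ∘ ρ := (congrArg (Prod.snd ∘ ·) hρ :)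
    have hp : p s' = p s ∘ π := hπ
    rw [hF_monomial, hF_monomial, hk, hp, hq, rowMean_comp_equiv]) hrow
  have hG : G P = 0 := map_eq_zero_of_splitHom_eq_zero G (fun s s' hf hg => by
    obtain ⟨π, hπ⟩ := exists_equiv_of_mapDomain_eq (hw s) (hw s') hf
    obtain ⟨ρ, hρ⟩ := exists_equiv_of_mapDomain_eq (hw s) (hw s') hg
    have hk : k s' = k s ∘ ρ := (congrArg (Prod.fst ∘ ·) hρ :)
    have hp : p s' = p s ∘ ρ := (congrArg (Prod.snd ∘ ·) hρ :)
    have hq : q s' = q s ∘ π := hπ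
    rw [hG_monomial, hG_monomial, hk, hp, hq, colResidualMean_comp_equiv]) hcol
  rw [← AlgHom.toLinearMap_apply, hΦFG, LinearMap.add_apply, hF, hG, add_zero]

end SplitMaps

section PolarForm

open Finset QuadraticMap

theorem forall_map_sum_smul_eq_zero_iff (S : Type*) [Field S] [NeZero (2 : S)] {A V κ : Type*}
    [CommRing A] [Algebra S A] [AddCommGroup V] [Module A V] [Fintype κ] (Q : QuadraticForm A V)
    (v : κ → V) :
    (∀ c : κ → S, Q (∑ k, algebraMap S A (c k) • v k) = 0) ↔
      ∀ k l, polar Q (v k) (v l) = 0 := by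
  classical
  constructor
  · intro h k l
    have sum_single (k : κ) : ∑ i, algebraMap S A ((Pi.single k 1 : κ → S) i) • v i = v k := by
      rw [sum_eq_single k (fun i _ hi => by rw [Pi.single_eq_of_ne hi, map_zero, zero_smul])
        fun hk => absurd (mem_univ k) hk, Pi.single_eq_same, map_one, one_smul]
    have sum_add (c d : κ → S) : ∑ i, algebraMap S A ((c + d) i) • v i =
        ∑ i, algebraMap S A (c i) • v i + ∑ i, algebraMap S A (d i) • v i := by
      simp only [Pi.add_apply, map_add, add_smul, sum_add_distrib]
    have hk := h (Pi.single k 1)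
    have hl := h (Pi.single l 1)
    have hkl := h (Pi.single k 1 + Pi.single l 1)
    rw [sum_add] at hkl
    rw [sum_single] at hk hl hkl
    rw [sum_single] at hkl
    rw [polar, hkl, hk, hl, sub_zero, sub_zero]
  · intro h c
    set w := ∑ k, algebraMap S A (c k) • v k with hw
    have hpolar : polar Q w w = 0 := by
      rw [hw, ← polarBilin_apply_apply]
      simp only [map_sum, LinearMap.sum_apply, map_smul, LinearMap.smul_apply,
        polarBilin_apply_apply, h, smul_zero, sum_const_zero]
    rw [polar_self, two_nsmul, ← two_smul S] at hpolar
    exact (smul_eq_zero_iff_right (NeZero.ne (2 : S))).1 hpolar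

variable {A : Type*} [CommRing A]

theorem polar_det_fin_two (M N : Matrix (Fin 2) (Fin 2) A) :
    polar Matrix.det M N =
      M 0 0 * N 1 1 + N 0 0 * M 1 1 - M 0 1 * N 1 0 - N 0 1 * M 1 0 := by
  simp only [polar, Matrix.det_fin_two, Matrix.add_apply]
  ring

variable (A) in
/-- The determinant of `2 × 2` matrices as a quadratic form, whose polar form is bilinear. -/
def detQuadraticForm : QuadraticForm A (Matrix (Fin 2) (Fin 2) A) :=
  linMulLin (Matrix.entryLinearMap A A 0 0) (Matrix.entryLinearMap A A 1 1) -
    linMulLin (Matrix.entryLinearMap A A 0 1) (Matrix.entryLinearMap A A 1 0)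

theorem coe_detQuadraticForm : ⇑(detQuadraticForm A) = Matrix.det :=
  funext fun M => (M.det_fin_two).symm

theorem forall_det_sum_smul_eq_zero_iff (S : Type*) [Field S] [NeZero (2 : S)] [Algebra S A]
    {κ : Type*} [Fintype κ] (M : κ → Matrix (Fin 2) (Fin 2) A) :
    (∀ c : κ → S, (∑ k, algebraMap S A (c k) • M k).det = 0) ↔
      ∀ k l, polar Matrix.det (M k) (M l) = 0 := by
  simpa only [coe_detQuadraticForm] using
    forall_map_sum_smul_eq_zero_iff S (detQuadraticForm A) M

/-- Modulo the polar relations `L * adj M * N` is trilinear and alternating, hence controlled by the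
`3 × 3` minors of the flattening. -/
theorem mul_adjugate_mul_eq_zero [IsAddTorsionFree A] {L M N : Matrix (Fin 2) (Fin 2) A}
    (hLM : polar Matrix.det L M = 0) (hLN : polar Matrix.det L N = 0)
    (hMN : polar Matrix.det M N = 0)
    (hminor : ∀ a : Fin 3 → Fin 2 × Fin 2,
      (Matrix.of fun i j => ![L, M, N] j (a i).1 (a i).2).det = 0) :
    L * M.adjugate * N = 0 := by
  rw [polar_det_fin_two] at hLM hLN hMN
  simp only [Matrix.det_fin_three, Matrix.of_apply, Matrix.cons_val] at hminor
  have h₁ := hminor ![(0, 0), (0, 1), (1, 0)]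
  have h₂ := hminor ![(0, 0), (0, 1), (1, 1)]
  have h₃ := hminor ![(0, 0), (1, 0), (1, 1)]
  have h₄ := hminor ![(0, 1), (1, 0), (1, 1)]
  simp only [Matrix.cons_val] at h₁ h₂ h₃ h₄
  refine Matrix.ext fun i j => (nsmul_eq_zero_iff_right two_ne_zero).1 ?_
  fin_cases i <;> fin_cases j <;>
    simp only [Fin.zero_eta, Fin.mk_one, Matrix.mul_apply, Fin.sum_univ_two,
      Matrix.adjugate_fin_two, Matrix.of_apply, Matrix.cons_val, Matrix.cons_val', nsmul_eq_mul,
      Nat.cast_ofNat]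
  · linear_combination N 0 0 * hLM - M 0 0 * hLN + L 0 0 * hMN - h₁
  · linear_combination N 0 1 * hLM - M 0 1 * hLN + L 0 1 * hMN - h₂
  · linear_combination N 1 0 * hLM - M 1 0 * hLN + L 1 0 * hMN + h₃
  · linear_combination N 1 1 * hLM - M 1 1 * hLN + L 1 1 * hMN + h₄

end PolarForm

section WordRelations

open Equiv QuadraticMap

/-- The flattening of the tuple of matrices with coordinate vector `x`: its `k`-th column lists the
entries of the `k`-th matrix. It is the specialization at `x` of `flattening n m`. -/
def tupleFlattening {A : Type*} {n m : ℕ} (x : TupleVar n m → A) :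
    Matrix (Fin n × Fin n) (Fin m) A :=
  Matrix.of fun ij k => x (k, ij)

variable {m : ℕ} {A : Type*} [CommRing A] {x : TupleVar 2 m → A}

theorem mixedDiffVanishes_fin_two
    (hdet : ∀ k l, polar Matrix.det (tupleMatrix x k) (tupleMatrix x l) = 0) (k : Fin 2 → Fin m) :
    MixedDiffVanishes x k (swap 0 1) (swap 0 1) := fun p q => by
  have h := hdet (k 0) (k 1)
  simp only [polar_det_fin_two, tupleMatrix, Matrix.of_apply] at h
  simp only [wordProd, Fin.prod_univ_two, Function.comp_apply, swap_apply_left, swap_apply_right]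
  generalize p 0 = p₀, p 1 = p₁, q 0 = q₀, q 1 = q₁
  fin_cases p₀ <;> fin_cases p₁ <;> fin_cases q₀ <;> fin_cases q₁ <;>
    simp only [Fin.zero_eta, Fin.mk_one] <;>
    first | ring1 | linear_combination h | linear_combination -h

theorem mixedDiffVanishes_fin_three [IsAddTorsionFree A]
    (hdet : ∀ k l, polar Matrix.det (tupleMatrix x k) (tupleMatrix x l) = 0)
    (hminor : ∀ (a : Fin 3 → Fin 2 × Fin 2) (b : Fin 3 → Fin m),
      ((tupleFlattening x).submatrix a b).det = 0) (k : Fin 3 → Fin m) :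
    MixedDiffVanishes x k (swap 0 1) (swap 0 2) := fun p q => by
  have h : tupleMatrix x (k 2) * (tupleMatrix x (k 0)).adjugate * tupleMatrix x (k 1) = 0 := by
    refine mul_adjugate_mul_eq_zero (hdet _ _) (hdet _ _) (hdet _ _) fun a => ?_
    rw [← hminor a ![k 2, k 0, k 1]]
    congr 1
    ext i j
    fin_cases j <;> rfl
  replace h := congrFun₂ h (p 2) (q 1)
  simp only [Matrix.mul_apply, Fin.sum_univ_two, Matrix.adjugate_fin_two, tupleMatrix,
    Matrix.of_apply, Matrix.cons_val, Matrix.cons_val', Matrix.zero_apply] at h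
  have swap_rows : swap (0 : Fin 3) 1 2 = 2 := by decide
  have swap_cols : swap (0 : Fin 3) 2 1 = 1 := by decide
  simp only [wordProd, Fin.prod_univ_three, Function.comp_apply, swap_apply_left, swap_apply_right,
    swap_rows, swap_cols]
  generalize p 0 = p₀, p 1 = p₁, q 0 = q₀, q 2 = q₂
  fin_cases p₀ <;> fin_cases p₁ <;> fin_cases q₀ <;> fin_cases q₂ <;>
    simp only [Fin.zero_eta, Fin.mk_one] <;>
    first | ring1 | linear_combination h | linear_combination -h

end WordRelations

section Rank

variable {K ι κ : Type*} [Field K] [Fintype κ]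

theorem two_mul_rank_le_card_of_transpose_mul_mul_eq_zero [Fintype ι] [DecidableEq ι]
    {N : Matrix ι κ K} {S : Matrix ι ι K} (hS : IsUnit S.det) (h : N.transpose * (S * N) = 0) :
    2 * N.rank ≤ Fintype.card ι := by
  have hrank := Matrix.rank_add_rank_le_card_of_mul_eq_zero h
  rwa [Matrix.rank_mul_eq_right_of_isUnit_det _ _ hS, Matrix.rank_transpose, ← two_mul] at hrank

theorem det_submatrix_eq_zero_of_rank_lt {N : Matrix ι κ K} {r : ℕ} (h : N.rank < r)
    (a : Fin r → ι) (b : Fin r → κ) : (N.submatrix a b).det = 0 := by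
  by_contra hdet
  have hunit : IsUnit (N.submatrix a b) :=
    (Matrix.isUnit_iff_isUnit_det _).2 (isUnit_iff_ne_zero.2 hdet)
  have hle := N.rank_submatrix_le a b
  rw [Matrix.rank_of_isUnit _ hunit, Fintype.card_fin] at hle
  exact hle.not_gt h

theorem rank_tupleFlattening_le_two {m : ℕ} {x : TupleVar 2 m → K}
    (hdet : ∀ k l, QuadraticMap.polar Matrix.det (tupleMatrix x k) (tupleMatrix x l) = 0) :
    (tupleFlattening x).rank ≤ 2 := by
  let J : Matrix (Fin 2) (Fin 2) K := !![0, 1; -1, 0]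
  -- `J ⊗ J` is the Gram matrix of the polar form of the determinant.
  let S : Matrix (Fin 2 × Fin 2) (Fin 2 × Fin 2) K := Matrix.kroneckerMap (· * ·) J J
  have hS : IsUnit S.det := by
    rw [Matrix.det_kronecker]
    simp [J, Matrix.det_fin_two]
  have hgram : (tupleFlattening x).transpose * (S * tupleFlattening x) = 0 := by
    ext k l
    have h := hdet k l
    simp only [polar_det_fin_two, tupleMatrix, Matrix.of_apply] at h
    simp only [Matrix.mul_apply, Fintype.sum_prod_type, Fin.sum_univ_two, tupleFlattening, S, J,
      Matrix.transpose_apply, Matrix.of_apply, Matrix.kroneckerMap_apply, Matrix.cons_val',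
      Matrix.cons_val, Matrix.zero_apply]
    linear_combination h
  have h := two_mul_rank_le_card_of_transpose_mul_mul_eq_zero hS hgram
  rw [Fintype.card_prod, Fintype.card_fin] at h
  lia

end Rank

section SingularTuples

open QuadraticMap

variable {n m : ℕ} {A : Type*} [CommRing A] [Algebra ℂ A]

theorem map_detForm (Φ : MvPolynomial (TupleVar n m) ℂ →ₐ[ℂ] A) (c : Fin m → ℂ) :
    Φ (detForm n m c) =
      (∑ k, algebraMap ℂ A (c k) • tupleMatrix (fun v => Φ (X v)) k).det := by
  rw [detForm, AlgHom.map_det]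
  congr 1
  ext i j
  simp only [AlgHom.mapMatrix_apply, Matrix.map_apply, Matrix.sum_apply, Matrix.smul_apply,
    tupleMatrix, Matrix.of_apply, map_sum, smul_eq_mul, map_mul, ← algebraMap_eq, AlgHom.commutes]

theorem map_det_flattening_submatrix (Φ : MvPolynomial (TupleVar n m) ℂ →ₐ[ℂ] A) {r : ℕ}
    (a : Fin r → Fin n × Fin n) (b : Fin r → Fin m) :
    Φ ((flattening n m).submatrix a b).det =
      ((tupleFlattening fun v => Φ (X v)).submatrix a b).det :=
  Φ.map_det _

theorem det_flattening_submatrix_mem {r : ℕ} {K : Ideal (MvPolynomial (TupleVar n m) ℂ)}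
    (hK : flatteningMinors n m r ⊆ K) (a : Fin r → Fin n × Fin n) (b : Fin r → Fin m) :
    ((flattening n m).submatrix a b).det ∈ K := by
  by_cases ha : Function.Injective a
  · by_cases hb : Function.Injective b
    · exact hK ⟨⟨a, ha⟩, ⟨b, hb⟩, rfl⟩
    · obtain ⟨i, j, hij, hne⟩ := Function.not_injective_iff.1 hb
      rw [Matrix.det_zero_of_column_eq hne fun t => by simp only [Matrix.submatrix_apply, hij]]
      exact K.zero_mem
  · obtain ⟨i, j, hij, hne⟩ := Function.not_injective_iff.1 ha
    rw [Matrix.det_zero_of_row_eq hne (by ext t; simp only [Matrix.submatrix_apply, hij])]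
    exact K.zero_mem

theorem span_detForm_le_ker_iff (Φ : MvPolynomial (TupleVar 2 m) ℂ →ₐ[ℂ] A) :
    Ideal.span (Set.range (detForm 2 m)) ≤ RingHom.ker Φ ↔
      ∀ k l, polar Matrix.det (tupleMatrix (fun v => Φ (X v)) k)
        (tupleMatrix (fun v => Φ (X v)) l) = 0 := by
  rw [← forall_det_sum_smul_eq_zero_iff ℂ, Ideal.span_le, Set.range_subset_iff]
  simp only [SetLike.mem_coe, RingHom.mem_ker, map_detForm]

theorem mem_singVariety_two_iff {x : TupleVar 2 m → ℂ} :
    x ∈ singVariety 2 m ↔ ∀ k l, polar Matrix.det (tupleMatrix x k) (tupleMatrix x l) = 0 :=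
  forall_det_sum_smul_eq_zero_iff ℚ (tupleMatrix x)

theorem zeroLocus_span_detForm :
    zeroLocus ℂ (Ideal.span (Set.range (detForm 2 m))) = singVariety 2 m := by
  ext x
  have h := span_detForm_le_ker_iff (aeval x : MvPolynomial (TupleVar 2 m) ℂ →ₐ[ℂ] ℂ)
  simp only [aeval_X] at h
  exact h.trans mem_singVariety_two_iff.symm

theorem singIdeal_two_eq_radical :
    singIdeal 2 m = (Ideal.span (Set.range (detForm 2 m))).radical := by
  rw [← vanishingIdeal_zeroLocus_eq_radical (K := ℂ), zeroLocus_span_detForm, singIdeal]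

theorem detForm_mem_singIdeal (c : Fin m → ℂ) : detForm 2 m c ∈ singIdeal 2 m :=
  singIdeal_two_eq_radical (m := m) ▸ Ideal.le_radical (Ideal.subset_span ⟨c, rfl⟩)

theorem flatteningMinors_subset_singIdeal :
    flatteningMinors 2 m 3 ⊆ (singIdeal 2 m : Set (MvPolynomial (TupleVar 2 m) ℂ)) := by
  rintro _ ⟨a, b, rfl⟩ x hx
  rw [map_det_flattening_submatrix]
  simp only [aeval_X]
  exact det_submatrix_eq_zero_of_rank_lt
    (Nat.lt_succ_of_le (rank_tupleFlattening_le_two (mem_singVariety_two_iff.1 hx))) a b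

theorem splitHom_row_eq_zero {f : MvPolynomial (TupleVar 2 m) ℂ} (hf : f ∈ singIdeal 2 m) :
    splitHom (fun v => v.2.1) (fun v => (v.1, v.2.2)) f = 0 :=
  splitHom_eq_zero_of_forall_eval fun u v => hf _ <| mem_singVariety_two_iff.2 fun k l => by
    simp only [polar_det_fin_two, tupleMatrix, Matrix.of_apply]
    ring

theorem splitHom_col_eq_zero {f : MvPolynomial (TupleVar 2 m) ℂ} (hf : f ∈ singIdeal 2 m) :
    splitHom (fun v => v.2.2) (fun v => (v.1, v.2.1)) f = 0 :=
  splitHom_eq_zero_of_forall_eval fun u v => hf _ <| mem_singVariety_two_iff.2 fun k l => by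
    simp only [polar_det_fin_two, tupleMatrix, Matrix.of_apply]
    ring

theorem singIdeal_le_ker {Φ : MvPolynomial (TupleVar 2 m) ℂ →ₐ[ℂ] A}
    (hdet : Ideal.span (Set.range (detForm 2 m)) ≤ RingHom.ker Φ)
    (hminor : flatteningMinors 2 m 3 ⊆ (RingHom.ker Φ : Set (MvPolynomial (TupleVar 2 m) ℂ))) :
    singIdeal 2 m ≤ RingHom.ker Φ := fun f hf => by
  let _ : Module ℚ≥0 A := Module.compHom A (algebraMap ℚ≥0 ℂ)
  have : IsAddTorsionFree A := .of_module_nnrat A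
  rw [span_detForm_le_ker_iff] at hdet
  refine map_eq_zero_of_mixedDiffVanishes Φ (fun _ => ?_) (splitHom_row_eq_zero hf)
    (splitHom_col_eq_zero hf)
  refine MixedDiffVanishes.of_swaps (mixedDiffVanishes_fin_two hdet)
    (mixedDiffVanishes_fin_three hdet fun a b => ?_)
  rw [← map_det_flattening_submatrix]
  exact det_flattening_submatrix_mem hminor a b

theorem singIdeal_two_eq_span_detForm_union_flatteningMinors :
    singIdeal 2 m = Ideal.span (Set.range (detForm 2 m) ∪ flatteningMinors 2 m 3) := by
  refine le_antisymm ?_ (Ideal.span_le.2 (Set.union_subset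
    (Set.range_subset_iff.2 detForm_mem_singIdeal) flatteningMinors_subset_singIdeal))
  set K := Ideal.span (Set.range (detForm 2 m) ∪ flatteningMinors 2 m 3)
  have hker : RingHom.ker (Ideal.Quotient.mkₐ ℂ K) = K := Ideal.Quotient.mkₐ_ker ℂ K
  have h := singIdeal_le_ker (Φ := Ideal.Quotient.mkₐ ℂ K)
  rw [hker] at h
  exact h (Ideal.span_mono Set.subset_union_left) (Set.subset_union_right.trans Ideal.subset_span)

end SingularTuples

section Grading

variable {V R : Type*}

theorem isHomogeneous_det [CommRing R] {ι : Type*} [Fintype ι] [DecidableEq ι]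
    {M : Matrix ι ι (MvPolynomial V R)} {d : ℕ} (hM : ∀ i j, (M i j).IsHomogeneous d) :
    M.det.IsHomogeneous (Fintype.card ι * d) := by
  rw [Matrix.det_apply]
  refine IsHomogeneous.sum _ _ _ fun σ _ => ?_
  have h : (∏ i, M (σ i) i).IsHomogeneous (Fintype.card ι * d) := by
    simpa using IsHomogeneous.prod Finset.univ _ (fun _ => d) fun i _ => hM (σ i) i
  rw [Units.smul_def]
  exact (homogeneousSubmodule V R _).toAddSubgroup.zsmul_mem h _

theorem isHomogeneous_detForm (n m : ℕ) (c : Fin m → ℂ) : (detForm n m c).IsHomogeneous n := by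
  have h : (detForm n m c).IsHomogeneous (Fintype.card (Fin n) * 1) :=
    isHomogeneous_det fun i j => by
      rw [Matrix.sum_apply]
      exact IsHomogeneous.sum _ _ _ fun k _ => isHomogeneous_C_mul_X (c k) (k, i, j)
  rwa [Fintype.card_fin, mul_one] at h

theorem isHomogeneous_of_mem_flatteningMinors {n m r : ℕ} {f : MvPolynomial (TupleVar n m) ℂ}
    (hf : f ∈ flatteningMinors n m r) : f.IsHomogeneous r := by
  obtain ⟨a, b, rfl⟩ := hf
  have h := isHomogeneous_det (M := (flattening n m).submatrix a b) fun i j => isHomogeneous_X ℂ _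
  rwa [Fintype.card_fin, mul_one] at h

theorem homogeneousComponent_mul_of_isHomogeneous [CommSemiring R] {f : MvPolynomial V R} {d : ℕ}
    (hf : f.IsHomogeneous d) (g : MvPolynomial V R) :
    homogeneousComponent d (f * g) = coeff 0 g • f := by
  let _ := gradedAlgebra (σ := V) (R := R)
  have hcomp (e : ℕ) (g : MvPolynomial V R) : homogeneousComponent e g =
      DirectSum.decompose (homogeneousSubmodule V R) g e :=
    (decomposition.decompose'_apply g e).symm
  rw [hcomp, DirectSum.coe_decompose_mul_of_left_mem_of_le (homogeneousSubmodule V R) hf le_rfl,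
    Nat.sub_self, ← hcomp, homogeneousComponent_zero, mul_comm, ← smul_eq_C_mul]

theorem homogeneousComponent_mul_of_isHomogeneous_of_lt [CommSemiring R] {f : MvPolynomial V R}
    {d e : ℕ} (hf : f.IsHomogeneous e) (hde : d < e) (g : MvPolynomial V R) :
    homogeneousComponent d (f * g) = 0 := by
  let _ := gradedAlgebra (σ := V) (R := R)
  have h := DirectSum.coe_decompose_mul_of_left_mem_of_not_le (b := g)
    (homogeneousSubmodule V R) hf hde.not_ge
  rwa [← decomposition.decompose'_apply]

theorem homogeneousComponent_mem_span_of_mem_span [CommSemiring R] {d : ℕ}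
    {S T : Set (MvPolynomial V R)} (hS : ∀ f ∈ S, f.IsHomogeneous d)
    (hT : ∀ f ∈ T, ∃ e, d < e ∧ f.IsHomogeneous e) {f : MvPolynomial V R}
    (hf : f ∈ Ideal.span (S ∪ T)) : homogeneousComponent d f ∈ Submodule.span R S := by
  suffices h : ∀ g, homogeneousComponent d (f * g) ∈ Submodule.span R S by
    simpa only [mul_one] using h 1
  induction hf using Submodule.span_induction with
  | mem f hf =>
    intro g
    rcases hf with hfS | hfT
    · rw [homogeneousComponent_mul_of_isHomogeneous (hS f hfS)]
      exact Submodule.smul_mem _ _ (Submodule.subset_span hfS)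
    · obtain ⟨e, hde, he⟩ := hT f hfT
      rw [homogeneousComponent_mul_of_isHomogeneous_of_lt he hde]
      exact Submodule.zero_mem _
  | zero => simp
  | add f f' _ _ hf hf' =>
    intro g
    rw [add_mul, map_add]
    exact Submodule.add_mem _ (hf g) (hf' g)
  | smul r f _ hf =>
    intro g
    rw [smul_eq_mul, mul_comm r f, mul_assoc]
    exact hf (r * g)

variable {m : ℕ}

theorem singIdealComponent_two_eq_span_detForm :
    singIdealComponent 2 m 2 = Submodule.span ℂ (Set.range (detForm 2 m)) := by
  refine le_antisymm ?_ (Submodule.span_le.2 (Set.range_subset_iff.2 fun c =>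
    ⟨detForm_mem_singIdeal c, isHomogeneous_detForm 2 m c⟩))
  rintro f ⟨hf, hf2⟩
  have hf' : f ∈ Ideal.span (Set.range (detForm 2 m) ∪ flatteningMinors 2 m 3) :=
    singIdeal_two_eq_span_detForm_union_flatteningMinors (m := m) ▸ hf
  have h := homogeneousComponent_mem_span_of_mem_span
    (Set.forall_mem_range.2 (isHomogeneous_detForm 2 m))
    (fun g hg => ⟨3, Nat.lt_succ_self 2, isHomogeneous_of_mem_flatteningMinors hg⟩) hf'
  rwa [homogeneousComponent_of_mem hf2, if_pos rfl] at h

theorem span_singIdealComponent_two :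
    Ideal.span (singIdealComponent 2 m 2 : Set (MvPolynomial (TupleVar 2 m) ℂ)) =
      Ideal.span (Set.range (detForm 2 m)) := by
  rw [singIdealComponent_two_eq_span_detForm]
  exact Submodule.span_span_of_tower ℂ _ _

end Grading

section NotRadical

open QuadraticMap

/-- Three `2 × 2` matrices. If `s` and `d` have square zero, they are isotropic and pairwise
orthogonal for the determinant, although the minor of their flattening in the rows `(0, 0)`,
`(0, 1)`, `(1, 0)` is `-2 * s * d`. -/
def nilTriple {A : Type*} [CommRing A] (s d : A) : Fin 3 → Matrix (Fin 2) (Fin 2) A :=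
  ![!![1, 0; 0, 0], !![0, s; s, 0], !![0, d; -d, 0]]

theorem polar_det_nilTriple {A : Type*} [CommRing A] {s d : A} (hs : s * s = 0) (hd : d * d = 0)
    (i j : Fin 3) : polar Matrix.det (nilTriple s d i) (nilTriple s d j) = 0 := by
  rw [polar_det_fin_two]
  fin_cases i <;> fin_cases j <;>
    simp only [nilTriple, Fin.zero_eta, Fin.mk_one, Fin.reduceFinMk, Matrix.of_apply,
      Matrix.cons_val, Matrix.cons_val'] <;>
    first | ring1 | linear_combination -2 * hs | linear_combination 2 * hd

theorem polar_det_extend_nilTriple {A κ : Type*} [CommRing A] {s d : A} (hs : s * s = 0)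
    (hd : d * d = 0) (b : Fin 3 ↪ κ) (k l : κ) :
    polar Matrix.det (Function.extend b (nilTriple s d) 0 k)
      (Function.extend b (nilTriple s d) 0 l) = 0 := by
  have apply_of_notMem {k : κ} (hk : ¬∃ i, b i = k) : Function.extend b (nilTriple s d) 0 k = 0 :=
    Function.extend_apply' _ _ _ hk
  by_cases hk : ∃ i, b i = k
  · by_cases hl : ∃ j, b j = l
    · obtain ⟨i, rfl⟩ := hk
      obtain ⟨j, rfl⟩ := hl
      rw [b.injective.extend_apply, b.injective.extend_apply, polar_det_nilTriple hs hd]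
    · simp [apply_of_notMem hl, polar_det_fin_two]
  · simp [apply_of_notMem hk, polar_det_fin_two]

theorem mul_eq_zero_of_isRadical_span_detForm {m : ℕ} (hm : 3 ≤ m)
    (hrad : (Ideal.span (Set.range (detForm 2 m))).IsRadical) {A : Type*} [CommRing A] [Algebra ℂ A]
    {s d : A} (hs : s * s = 0) (hd : d * d = 0) : s * d = 0 := by
  let b : Fin 3 ↪ Fin m := Fin.castLEEmb hm
  let a : Fin 3 ↪ Fin 2 × Fin 2 := ⟨![(0, 0), (0, 1), (1, 0)], by decide⟩
  let M : Fin m → Matrix (Fin 2) (Fin 2) A := Function.extend b (nilTriple s d) 0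
  have hM (i : Fin 3) : M (b i) = nilTriple s d i := b.injective.extend_apply _ _ i
  let Φ : MvPolynomial (TupleVar 2 m) ℂ →ₐ[ℂ] A := aeval fun v => M v.1 v.2.1 v.2.2
  have hΦ (v : TupleVar 2 m) : Φ (X v) = M v.1 v.2.1 v.2.2 := aeval_X _ v
  have hker : Ideal.span (Set.range (detForm 2 m)) ≤ RingHom.ker Φ := by
    rw [span_detForm_le_ker_iff]
    simp only [hΦ]
    exact polar_det_extend_nilTriple hs hd b
  have hmem : ((flattening 2 m).submatrix a b).det ∈ Ideal.span (Set.range (detForm 2 m)) := by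
    rw [← hrad.radical, ← singIdeal_two_eq_radical]
    exact flatteningMinors_subset_singIdeal ⟨a, b, rfl⟩
  have hminor : Φ ((flattening 2 m).submatrix a b).det = -2 * (s * d) := by
    rw [map_det_flattening_submatrix, Matrix.det_fin_three]
    simp only [tupleFlattening, Matrix.submatrix_apply, Matrix.of_apply, hΦ, hM, nilTriple, a,
      Function.Embedding.coeFn_mk, Matrix.cons_val, Matrix.cons_val']
    ring
  have hzero : (-2 : ℂ) • (s * d) = 0 := by
    rw [Algebra.smul_def, map_neg, map_ofNat, ← hminor]
    exact hker hmem
  exact (smul_eq_zero_iff_right (by norm_num)).1 hzero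

theorem not_isRadical_span_detForm {m : ℕ} (hm : 3 ≤ m) :
    ¬ (Ideal.span (Set.range (detForm 2 m))).IsRadical := fun hrad => by
  let s : DualNumber (DualNumber ℂ) := TrivSqZeroExt.inl DualNumber.eps
  have hs : s * s = 0 := by
    rw [← TrivSqZeroExt.inl_mul, DualNumber.eps_mul_eps, TrivSqZeroExt.inl_zero]
  have hsd : s * DualNumber.eps = 0 :=
    mul_eq_zero_of_isRadical_span_detForm (A := DualNumber (DualNumber ℂ)) hm hrad hs
      DualNumber.eps_mul_eps
  have hsnd := congrArg (fun z => z.snd.snd) hsd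
  simp [s] at hsnd

end NotRadical

theorem theorem3p1 (m : ℕ) (hm : 3 ≤ m) :
    singIdealComponent 2 m 2 = Submodule.span ℂ (Set.range (detForm 2 m)) ∧
    ¬ (Ideal.span (singIdealComponent 2 m 2 : Set (MvPolynomial (TupleVar 2 m) ℂ))).IsRadical ∧
    singIdeal 2 m =
      (Ideal.span (singIdealComponent 2 m 2 : Set (MvPolynomial (TupleVar 2 m) ℂ))).radical ∧
    singIdeal 2 m =
      Ideal.span ((singIdealComponent 2 m 2 : Set (MvPolynomial (TupleVar 2 m) ℂ)) ∪
        flatteningMinors 2 m 3) := by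
  rw [span_singIdealComponent_two, Ideal.span_union, span_singIdealComponent_two,
    ← Ideal.span_union]
  exact ⟨singIdealComponent_two_eq_span_detForm, not_isRadical_span_detForm hm,
    singIdeal_two_eq_radical, singIdeal_two_eq_span_detForm_union_flatteningMinors⟩
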